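/- Let $0\le\omega<1$. For an incidence angle $\theta_0\in(-\pi/2,\pi/2)$ put $\mu_0=\cos\theta_0$, and write $\mu=\cos\theta$. Consider the half-space albedo problem with isotropic (azimuth-independent) scattering for the diffuse flux $\psi_d(\theta,\tau)$, $-\pi<\theta\le\pi$, $\tau\ge 0$: $$\mu\,\frac{\partial\psi_d}{\partial\tau}(\theta,\tau)+\psi_d(\theta,\tau)=\frac{\omega}{2\pi}\int_{-\pi}^{\pi}\psi_d(\theta',\tau)\,d\theta'+\frac{\omega}{2\pi}e^{-\tau/\mu_0}\qquad(\tau>0),$$ $$\psi_d(\theta,0)=0\quad\text{for } |\theta|\le\pi/2 .$$ In the two directions with $\mu=0$ the derivative term is absent. A solution is understood to be integrable in $\theta$ at each depth $\tau>0$, to be differentiable in $\tau>0$ and continuous at $\tau=0$ for each direction with $\mu\ne0$, and to be such that $e^{-s\tau}\psi_d$ is, for every $s>0$, absolutely integrable over $\tau>0$ for each $\theta$ and over $(\theta,\tau)$ jointly (i.e. $\psi_d$ has a Laplace transform in $\tau$ for $\operatorname{Re}s>0$). Then a solution exists for every $\theta_0\in(-\pi/2,\pi/2)$, and the emergent flux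 of the solutions is described by a single function $D$ of two cosines in $(0,1]$, defined by $$\psi_d(\theta,0)=-\mu^{-1}D(-\mu,\mu_0)\qquad(\pi/2<|\theta|\le\pi,\ |\theta_0|<\pi/2).$$ This function is symmetric under interchange of the incident and emergent directions: $$D(\mu_0,-\mu)=D(-\mu,\mu_0)\qquad\text{for all } \theta_0,\theta \text{ with } |\theta_0|<\pi/2<|\theta|\le\pi .$$ -/

import Mathlib

open MeasureTheory Set

/-- `IsDiffuseFlux ω θ₀ ψ`: the function `ψ θ τ` (azimuth `-π < θ ≤ π`, optical depth `τ ≥ 0`) is the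
diffuse photon flux in the half space `τ ≥ 0` with single-scattering albedo `ω`, isotropic scattering
and unit plane-wave irradiation at azimuth `θ₀`. Throughout `μ = cos θ` and `μ₀ = cos θ₀`. -/
structure IsDiffuseFlux (ω θ₀ : ℝ) (ψ : ℝ → ℝ → ℝ) : Prop where
  /-- At each depth the angular aggregate `∫ ψ(θ', τ) dθ'` is meaningful. -/
  integrable_angle : ∀ τ : ℝ, 0 < τ →
    IntervalIntegrable (fun θ' => ψ θ' τ) volume (-Real.pi) Real.pi
  /-- The `τ`-derivative exists inside the medium. In the two grazing directions `μ = 0` the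
  derivative is absent from the transport equation and is not asked for. -/
  differentiable : ∀ θ ∈ Ioc (-Real.pi) Real.pi, Real.cos θ ≠ 0 →
    ∀ τ : ℝ, 0 < τ → DifferentiableAt ℝ (ψ θ) τ
  /-- The boundary values at `τ = 0` are attained, again off the grazing directions. -/
  continuous_zero : ∀ θ ∈ Ioc (-Real.pi) Real.pi, Real.cos θ ≠ 0 →
    ContinuousWithinAt (ψ θ) (Ici 0) 0
  /-- The transport (Boltzmann) equation for the diffuse flux,
  `μ ∂ψ/∂τ + ψ = (ω/2π) ∫ ψ(θ', τ) dθ' + (ω/2π) exp (-τ/μ₀)`. -/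
  transport : ∀ θ ∈ Ioc (-Real.pi) Real.pi, ∀ τ : ℝ, 0 < τ →
    Real.cos θ * deriv (ψ θ) τ + ψ θ τ =
      ω / (2 * Real.pi) * (∫ θ' in (-Real.pi)..Real.pi, ψ θ' τ)
        + ω / (2 * Real.pi) * Real.exp (-τ / Real.cos θ₀)
  /-- No reentrant diffuse flux at the boundary of the half space. -/
  no_reentrant : ∀ θ : ℝ, |θ| ≤ Real.pi / 2 → ψ θ 0 = 0
  /-- The flux in each direction has a Laplace transform in `τ` on `Re s > 0`. -/
  laplace : ∀ θ ∈ Ioc (-Real.pi) Real.pi, ∀ s : ℝ, 0 < s →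
    IntegrableOn (fun τ => Real.exp (-s * τ) * ψ θ τ) (Ioi 0)
  /-- The same jointly in angle and depth, so that the density `∫ ψ(θ', τ) dθ'` has one too. -/
  laplace_joint : ∀ s : ℝ, 0 < s →
    IntegrableOn (fun p : ℝ × ℝ => Real.exp (-s * p.2) * ψ p.1 p.2)
      (Ioc (-Real.pi) Real.pi ×ˢ Ioi 0)

/-- `IsDiffuseReflection ω D`: the function `D` is defined, on pairs (emergent cosine, incident
cosine), by `ψ(θ, 0) = -μ⁻¹ D(-μ, μ₀)` for all incident azimuths `θ₀`, all emergent azimuths `θ`,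
and `ψ` the diffuse flux under irradiation at `θ₀`. -/
def IsDiffuseReflection (ω : ℝ) (D : ℝ → ℝ → ℝ) : Prop :=
  ∀ θ₀ ∈ Ioo (-(Real.pi / 2)) (Real.pi / 2), ∀ ψ : ℝ → ℝ → ℝ, IsDiffuseFlux ω θ₀ ψ →
    ∀ θ ∈ Ioc (-Real.pi) Real.pi, Real.pi / 2 < |θ| →
      ψ θ 0 = -(Real.cos θ)⁻¹ * D (-Real.cos θ) (Real.cos θ₀)

/-! Everything is expressed through the source density `S`, the right-hand side of the transport
equation. Integrating along characteristics, `S` determines the flux off the grazing directions: it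
is `streamed μ S`, with `S` cut off to `τ > 0` (`eq_streamed_of_transport`). With `a = ω/2π`, `E(τ)
= exp (-τ/μ₀)` and `K` the angular integral of streaming, this gives `S = a K S + a E`, and `D(-μ,
μ₀)` is the Laplace transform of `S` at `-1/μ` (`emergent`).

Reversing directions, `θ ↦ θ + π`, shows that `K` is symmetric
(`integral_mul_integral_streamed_comm`). Hence, for two incident directions, `a ⟨E₁, S₂⟩ = ⟨S₁, S₂⟩
- a ⟨S₂, K S₁⟩` is symmetric in the indices, which is reciprocity (`integral_exp_mul_source_comm`).

Existence is a contraction argument with constant `ω` on bounded continuous functions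
(`exists_source`). Uniqueness of `S`, which makes `D` well defined, and integrability of `S`, which
makes the pairings finite, both follow from a bound in `L¹` with weight `exp (-s τ)`, uniform for
small `s` (`absLaplace_source_le`). -/

/-! ### Streaming along one direction -/

/-- The flux at depth `τ` in a direction of cosine `μ` that the source density `h` produces:
`∫₀^∞ exp (-u) h (τ - μ u) du`, with `u` the optical path back to the point of emission. -/
noncomputable def streamed (μ : ℝ) (h : ℝ → ℝ) (τ : ℝ) : ℝ :=
  ∫ u in Ioi (0 : ℝ), Real.exp (-u) * h (τ - μ * u)

lemma measurable_exp_neg_mul_comp {h : ℝ → ℝ} (hm : Measurable h) :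
    Measurable fun p : (ℝ × ℝ) × ℝ => Real.exp (-p.2) * h (p.1.2 - p.1.1 * p.2) := by
  fun_prop

lemma measurable_streamed {h : ℝ → ℝ} (hm : Measurable h) :
    Measurable fun p : ℝ × ℝ => streamed p.1 h p.2 :=
  ((measurable_exp_neg_mul_comp hm).stronglyMeasurable.integral_prod_right
    (ν := volume.restrict (Ioi (0 : ℝ)))).measurable

lemma integrableOn_exp_neg_mul_of_bounded {g : ℝ → ℝ} (hm : Measurable g) {M : ℝ}
    (hM : ∀ t, |g t| ≤ M) (c : ℝ) :
    IntegrableOn (fun u => Real.exp (-u) * g u) (Ioi c) := by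
  have h1 : IntegrableOn (fun u : ℝ => Real.exp (-u)) (Ioi c) := integrableOn_exp_neg_Ioi c
  exact h1.mul_bdd (c := M) hm.aestronglyMeasurable (ae_of_all _ fun u => by simpa using hM u)

lemma abs_streamed_le {h : ℝ → ℝ} {M : ℝ} (hM : ∀ t, |h t| ≤ M) (μ τ : ℝ) :
    |streamed μ h τ| ≤ M := by
  have h1 : IntegrableOn (fun u : ℝ => Real.exp (-u) * M) (Ioi 0) :=
    (integrableOn_exp_neg_Ioi 0).mul_const M
  have h2 := norm_integral_le_of_norm_le (μ := volume.restrict (Ioi (0 : ℝ)))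
    (f := fun u => Real.exp (-u) * h (τ - μ * u)) h1 (ae_of_all _ fun u => by
      rw [norm_mul, Real.norm_eq_abs, Real.abs_exp]
      exact mul_le_mul_of_nonneg_left (hM _) (Real.exp_pos _).le)
  rwa [integral_mul_const, integral_exp_neg_Ioi_zero, one_mul] at h2

lemma streamed_sub {g h : ℝ → ℝ} {μ τ : ℝ}
    (hg : IntegrableOn (fun u => Real.exp (-u) * g (τ - μ * u)) (Ioi 0))
    (hh : IntegrableOn (fun u => Real.exp (-u) * h (τ - μ * u)) (Ioi 0)) :
    streamed μ (fun t => g t - h t) τ = streamed μ g τ - streamed μ h τ := by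
  rw [streamed, streamed, streamed, ← integral_sub hg hh]
  exact integral_congr_ae (ae_of_all _ fun u => by ring)

lemma streamed_zero_cos (h : ℝ → ℝ) (τ : ℝ) : streamed 0 h τ = h τ := by
  simp only [streamed, zero_mul, sub_zero, integral_mul_const, integral_exp_neg_Ioi_zero, one_mul]

lemma streamed_of_nonneg_cos {h : ℝ → ℝ} (h0 : ∀ t ≤ 0, h t = 0) {μ : ℝ} (hμ : 0 ≤ μ) :
    streamed μ h 0 = 0 := by
  refine setIntegral_eq_zero_of_forall_eq_zero fun u hu => ?_
  rw [h0, mul_zero]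
  have := mul_nonneg hμ (le_of_lt (mem_Ioi.1 hu))
  linarith

/-- Substituting `w = u - v` removes the depth from the argument of `h`; it survives only in a
factor and an integration limit, so regularity in depth comes from the fundamental theorem of
calculus. -/
lemma streamed_shift {h : ℝ → ℝ} (hm : Measurable h) {M : ℝ} (hM : ∀ t, |h t| ≤ M) (μ v : ℝ) :
    streamed μ h (μ * v) =
      Real.exp (-v) * (streamed μ h 0 + ∫ w in (0 : ℝ)..(-v), -(Real.exp (-w) * h (-(μ * w)))) := by
  have hint : ∀ c, IntegrableOn (fun w => Real.exp (-w) * h (-(μ * w))) (Ioi c) :=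
    integrableOn_exp_neg_mul_of_bounded (by fun_prop) (fun t => hM _)
  have h1 := intervalIntegral.integral_Ioi_sub_Ioi' (hint 0) (hint (-v))
  have h2 : ∫ u in Ioi (0 : ℝ), Real.exp (-u) * h (μ * v - μ * u) =
      Real.exp (-v) * ∫ w in Ioi (-v), Real.exp (-w) * h (-(μ * w)) := by
    rw [← integral_const_mul, ← integral_indicator measurableSet_Ioi,
      ← integral_indicator measurableSet_Ioi,
      ← integral_sub_right_eq_self (μ := volume) (indicator (Ioi (-v)) _) v]
    congr 1
    ext u
    by_cases hu : 0 < u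
    · rw [indicator_of_mem (mem_Ioi.2 hu), indicator_of_mem (mem_Ioi.2 (by linarith)), ← mul_assoc,
        ← Real.exp_add]
      congr 2 <;> ring
    · rw [indicator_of_notMem (by simpa using hu), indicator_of_notMem (by simp; linarith)]
  rw [streamed, h2, intervalIntegral.integral_neg, ← h1]
  simp only [streamed, zero_sub]
  ring

lemma continuous_streamed {h : ℝ → ℝ} (hm : Measurable h) {M : ℝ} (hM : ∀ t, |h t| ≤ M)
    {μ : ℝ} (hμ : μ ≠ 0) : Continuous (streamed μ h) := by
  have hint : ∀ a b, IntervalIntegrable (fun w => -(Real.exp (-w) * h (-(μ * w)))) volume a b :=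
    fun a b => ((intervalIntegrable_iff.2 ((integrableOn_exp_neg_mul_of_bounded
      (g := fun w => h (-(μ * w))) (by fun_prop) (fun t => hM _) (min a b)).mono_set
        Ioc_subset_Ioi_self))).neg
  have h1 := intervalIntegral.continuous_primitive hint 0
  have h2 : streamed μ h = fun τ => Real.exp (-(τ / μ)) * (streamed μ h 0 +
      ∫ w in (0 : ℝ)..(-(τ / μ)), -(Real.exp (-w) * h (-(μ * w)))) := by
    ext τ
    rw [← streamed_shift hm hM μ (τ / μ), mul_div_cancel₀ _ hμ]
  rw [h2]
  have h3 : Continuous fun τ : ℝ => -(τ / μ) := by fun_prop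
  exact (Real.continuous_exp.comp h3).mul (continuous_const.add (h1.comp h3))

lemma hasDerivAt_streamed {h : ℝ → ℝ} (hm : Measurable h) {M : ℝ} (hM : ∀ t, |h t| ≤ M)
    {μ : ℝ} (hμ : μ ≠ 0) {τ : ℝ} (hc : ContinuousAt h τ) :
    HasDerivAt (streamed μ h) ((h τ - streamed μ h τ) / μ) τ := by
  have hint : IntervalIntegrable (fun w => -(Real.exp (-w) * h (-(μ * w)))) volume 0 (-(τ / μ)) :=
    ((intervalIntegrable_iff.2 ((integrableOn_exp_neg_mul_of_bounded
      (g := fun w => h (-(μ * w))) (by fun_prop) (fun t => hM _) (min 0 (-(τ / μ)))).mono_set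
        Ioc_subset_Ioi_self))).neg
  have hτ : -(μ * (-(τ / μ))) = τ := by field_simp
  have hcw : ContinuousAt (fun w => -(Real.exp (-w) * h (-(μ * w)))) (-(τ / μ)) := by
    have : ContinuousAt (fun w => h (-(μ * w))) (-(τ / μ)) :=
      ContinuousAt.comp (f := fun w => -(μ * w)) (by rwa [hτ]) (by fun_prop)
    exact (ContinuousAt.mul (by fun_prop) this).neg
  have hmw : Measurable (fun w => -(Real.exp (-w) * h (-(μ * w)))) := by fun_prop
  have h1 := intervalIntegral.integral_hasDerivAt_right hint
    (hmw.stronglyMeasurable.stronglyMeasurableAtFilter) hcw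
  have h2 : streamed μ h = fun τ => Real.exp (-(τ / μ)) * (streamed μ h 0 +
      ∫ w in (0 : ℝ)..(-(τ / μ)), -(Real.exp (-w) * h (-(μ * w)))) := by
    ext τ
    rw [← streamed_shift hm hM μ (τ / μ), mul_div_cancel₀ _ hμ]
  have h3 : HasDerivAt (fun τ : ℝ => -(τ / μ)) (-(1 / μ)) τ := ((hasDerivAt_id τ).div_const μ).neg
  have h4 := h3.exp.mul ((h1.comp τ h3).const_add (streamed μ h 0))
  have h5 := congrFun h2 τ
  refine (h4.congr_of_eventuallyEq (Filter.Eventually.of_forall (congrFun h2))).congr_deriv ?_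
  simp only [Function.comp_apply]
  rw [hτ, h5, neg_neg]
  have h6 : Real.exp (-(τ / μ)) * Real.exp (τ / μ) = 1 := by rw [← Real.exp_add]; simp
  field_simp
  linear_combination h τ * h6

/-! ### Angular integrals of the streamed flux -/

lemma ae_cos_ne_zero : ∀ᵐ θ : ℝ, Real.cos θ ≠ 0 := by
  have h : {θ : ℝ | Real.cos θ = 0}.Countable := by
    refine (countable_range fun k : ℤ => (2 * k + 1) * Real.pi / 2).mono fun θ hθ => ?_
    obtain ⟨k, hk⟩ := Real.cos_eq_zero_iff.1 hθ
    exact ⟨k, hk.symm⟩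
  exact (ae_iff.2 (by simpa using h.measure_zero volume))

lemma measurable_streamed_cos {h : ℝ → ℝ} (hm : Measurable h) (τ : ℝ) :
    Measurable fun θ => streamed (Real.cos θ) h τ :=
  (measurable_streamed hm).comp (Real.measurable_cos.prodMk measurable_const)

lemma intervalIntegrable_streamed_cos {h : ℝ → ℝ} (hm : Measurable h) {M : ℝ}
    (hM : ∀ t, |h t| ≤ M) (τ a b : ℝ) :
    IntervalIntegrable (fun θ => streamed (Real.cos θ) h τ) volume a b :=
  (intervalIntegrable_const (c := M)).mono_fun (measurable_streamed_cos hm τ).aestronglyMeasurable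
    (ae_of_all _ fun _ => (abs_streamed_le hM _ _).trans (le_abs_self M))

lemma continuous_integral_streamed_cos {h : ℝ → ℝ} (hm : Measurable h) {M : ℝ}
    (hM : ∀ t, |h t| ≤ M) (a b : ℝ) :
    Continuous fun τ => ∫ θ in a..b, streamed (Real.cos θ) h τ := by
  refine intervalIntegral.continuous_of_dominated_interval (bound := fun _ => M)
    (fun τ => (measurable_streamed_cos hm τ).aestronglyMeasurable)
    (fun τ => ae_of_all _ fun θ _ => abs_streamed_le hM _ _) intervalIntegrable_const ?_
  filter_upwards [ae_cos_ne_zero] with θ hθ _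
  exact continuous_streamed hm hM hθ

lemma abs_integral_streamed_cos_le {h : ℝ → ℝ} {M : ℝ} (hM : ∀ t, |h t| ≤ M) (τ : ℝ) :
    |∫ θ in (-Real.pi)..Real.pi, streamed (Real.cos θ) h τ| ≤ 2 * Real.pi * M := by
  have := intervalIntegral.norm_integral_le_of_norm_le_const (a := -Real.pi) (b := Real.pi)
    (f := fun θ => streamed (Real.cos θ) h τ) (C := M) fun θ _ => abs_streamed_le hM _ _
  rw [abs_of_nonneg (by linarith [Real.pi_pos])] at this
  rw [← Real.norm_eq_abs]
  linarith

/-! ### Existence of a solution -/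

open BoundedContinuousFunction in
/-- The integral equation for the source density of the half-space albedo problem. -/
lemma exists_source {ω : ℝ} (hω₀ : 0 ≤ ω) (hω₁ : ω < 1) {μ₀ : ℝ} (hμ₀ : 0 < μ₀) :
    ∃ f : ℝ →ᵇ ℝ, ∀ τ, f τ =
      ω / (2 * Real.pi) * (∫ θ in (-Real.pi)..Real.pi,
        streamed (Real.cos θ) (indicator (Ioi 0) f) τ)
      + ω / (2 * Real.pi) * Real.exp (-|τ| / μ₀) := by
  have hπ := Real.pi_pos
  have hmeas : ∀ f : ℝ →ᵇ ℝ, Measurable (indicator (Ioi 0) f) := fun f =>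
    f.continuous.measurable.indicator measurableSet_Ioi
  have hbd : ∀ f : ℝ →ᵇ ℝ, ∀ t, |indicator (Ioi 0) f t| ≤ ‖f‖ := fun f t =>
    (norm_indicator_le_norm_self _ _).trans (f.norm_coe_le_norm t)
  -- The absolute value keeps the inhomogeneity bounded on the whole line; only `τ > 0` matters
  -- later.
  have hexp : ∀ τ : ℝ, |Real.exp (-|τ| / μ₀)| ≤ 1 := fun τ => by
    rw [Real.abs_exp, Real.exp_le_one_iff]
    exact div_nonpos_of_nonpos_of_nonneg (by simp) hμ₀.le
  set a := ω / (2 * Real.pi) with ha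
  have ha0 : 0 ≤ a := by positivity
  let T : (ℝ →ᵇ ℝ) → (ℝ →ᵇ ℝ) := fun f => ofNormedAddCommGroup
    (fun τ => a * (∫ θ in (-Real.pi)..Real.pi, streamed (Real.cos θ) (indicator (Ioi 0) f) τ)
      + a * Real.exp (-|τ| / μ₀))
    (((continuous_integral_streamed_cos (hmeas f) (hbd f) _ _).const_mul a).add (by fun_prop))
    (a * (2 * Real.pi * ‖f‖) + a * 1) (fun τ => by
      refine (norm_add_le _ _).trans ?_
      rw [norm_mul, norm_mul, Real.norm_of_nonneg ha0]
      gcongr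
      · exact abs_integral_streamed_cos_le (hbd f) τ
      · exact hexp τ)
  -- Streaming does not increase the sup norm, and the angular integral contributes `2π`, so the
  -- constant is `2π a = ω`.
  have hT : ContractingWith ⟨ω, hω₀⟩ T := by
    refine ⟨by exact_mod_cast hω₁, LipschitzWith.of_dist_le_mul fun f g => ?_⟩
    refine (dist_le (by positivity)).2 fun τ => ?_
    have h1 : T f τ - T g τ = a * ∫ θ in (-Real.pi)..Real.pi,
        streamed (Real.cos θ) (indicator (Ioi 0) (f - g : ℝ →ᵇ ℝ)) τ := by
      have h2 : ∀ θ, streamed (Real.cos θ) (indicator (Ioi 0) (f - g : ℝ →ᵇ ℝ)) τ =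
          streamed (Real.cos θ) (indicator (Ioi 0) f) τ -
            streamed (Real.cos θ) (indicator (Ioi 0) g) τ := fun θ => by
        rw [← streamed_sub]
        · congr 1
          ext t
          by_cases ht : t ∈ Ioi (0 : ℝ) <;> simp [ht]
        · exact integrableOn_exp_neg_mul_of_bounded (g := fun u =>
            indicator (Ioi 0) f (τ - Real.cos θ * u)) ((hmeas f).comp (by fun_prop))
            (fun t => hbd f _) 0
        · exact integrableOn_exp_neg_mul_of_bounded (g := fun u =>
            indicator (Ioi 0) g (τ - Real.cos θ * u)) ((hmeas g).comp (by fun_prop))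
            (fun t => hbd g _) 0
      simp only [h2]
      rw [intervalIntegral.integral_sub (intervalIntegrable_streamed_cos (hmeas f) (hbd f) _ _ _)
        (intervalIntegrable_streamed_cos (hmeas g) (hbd g) _ _ _)]
      simp only [T, coe_ofNormedAddCommGroup]
      ring
    rw [Real.dist_eq, h1, abs_mul, abs_of_nonneg ha0, dist_eq_norm]
    calc a * _ ≤ a * (2 * Real.pi * ‖f - g‖) := by
          gcongr
          exact abs_integral_streamed_cos_le (hbd (f - g)) τ
      _ = ω * ‖f - g‖ := by rw [ha]; field_simp
  refine ⟨hT.fixedPoint T, fun τ => ?_⟩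
  have h3 := congrArg (fun f : ℝ →ᵇ ℝ => f τ) hT.fixedPoint_isFixedPt.eq
  exact h3.symm

lemma isDiffuseFlux_streamed {ω θ₀ : ℝ} {f : ℝ → ℝ} (hc : Continuous f)
    {M : ℝ} (hM : ∀ t, |f t| ≤ M)
    (hf : ∀ τ, f τ = ω / (2 * Real.pi) * (∫ θ in (-Real.pi)..Real.pi,
        streamed (Real.cos θ) (indicator (Ioi 0) f) τ)
      + ω / (2 * Real.pi) * Real.exp (-|τ| / Real.cos θ₀)) :
    IsDiffuseFlux ω θ₀ fun θ τ => streamed (Real.cos θ) (indicator (Ioi 0) f) τ := by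
  set h := indicator (Ioi 0) f with hh
  have hm : Measurable h := hc.measurable.indicator measurableSet_Ioi
  have hMh : ∀ t, |h t| ≤ M := fun t =>
    (norm_indicator_le_norm_self (s := Ioi 0) f t).trans (hM t)
  have hpos : ∀ τ, 0 < τ → h τ = f τ := fun τ hτ => indicator_of_mem (mem_Ioi.2 hτ) f
  have hcont : ∀ τ, 0 < τ → ContinuousAt h τ := fun τ hτ =>
    hc.continuousAt.congr (by
      filter_upwards [Ioi_mem_nhds hτ] with t ht using (hpos t ht).symm)
  have hneg : ∀ t ≤ 0, h t = 0 := fun t ht => indicator_of_notMem (by simpa using ht) f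
  have hexp : ∀ s : ℝ, 0 < s → IntegrableOn (fun τ : ℝ => Real.exp (-s * τ)) (Ioi 0) :=
    fun s hs => integrableOn_exp_mul_Ioi (by linarith) 0
  refine ⟨fun τ _ => intervalIntegrable_streamed_cos hm hMh τ _ _,
    fun θ _ hθ τ hτ => (hasDerivAt_streamed hm hMh hθ (hcont τ hτ)).differentiableAt,
    fun θ _ hθ => (continuous_streamed hm hMh hθ).continuousWithinAt, fun θ _ τ hτ => ?_,
    fun θ hθ => streamed_of_nonneg_cos hneg (Real.cos_nonneg_of_mem_Icc (abs_le.1 hθ)),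
    fun θ _ s hs => ?_, fun s hs => ?_⟩
  · have h1 : Real.cos θ * deriv (fun τ => streamed (Real.cos θ) h τ) τ
        + streamed (Real.cos θ) h τ = h τ := by
      by_cases hθ : Real.cos θ = 0
      · rw [hθ, zero_mul, zero_add, streamed_zero_cos]
      · rw [(hasDerivAt_streamed hm hMh hθ (hcont τ hτ)).deriv]
        field_simp
        ring
    rw [h1, hpos τ hτ, hf, abs_of_pos hτ]
  · exact (hexp s hs).mul_bdd (c := M)
      ((measurable_streamed hm).comp (measurable_const.prodMk measurable_id)).aestronglyMeasurable
      (ae_of_all _ fun τ => abs_streamed_le hMh _ _)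
  · have h1 : IntegrableOn (fun p : ℝ × ℝ => Real.exp (-s * p.2))
        (Ioc (-Real.pi) Real.pi ×ˢ Ioi 0) := by
      rw [IntegrableOn, Measure.volume_eq_prod, ← Measure.prod_restrict]
      exact Integrable.comp_snd (f := fun τ => Real.exp (-s * τ)) (hexp s hs) _
    exact h1.mul_bdd (c := M)
      ((measurable_streamed hm).comp
        ((Real.measurable_cos.comp measurable_fst).prodMk measurable_snd)).aestronglyMeasurable
      (ae_of_all _ fun p => abs_streamed_le hMh _ _)

/-! ### Symmetry of isotropic streaming -/

lemma integrable_mul_exp_neg_mul {g h : ℝ → ℝ} (hh : Measurable h)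
    (hgi : Integrable g) {M : ℝ} (hM : ∀ t, |h t| ≤ M) (μ : ℝ) :
    Integrable (fun p : ℝ × ℝ => g p.1 * (Real.exp (-p.2) * h (p.1 - μ * p.2)))
      (volume.prod (volume.restrict (Ioi 0))) := by
  have h1 := (hgi.mul_prod (integrableOn_exp_neg_Ioi 0)).mul_bdd (c := M)
    (g := fun p : ℝ × ℝ => h (p.1 - μ * p.2)) (hh.comp (by fun_prop)).aestronglyMeasurable
    (ae_of_all _ fun _ => hM _)
  exact h1.congr (ae_of_all _ fun p => mul_assoc _ _ _)

/-- For each path length `u`, the translation `τ ↦ τ + μ u` moves the shift from `h` to `g` and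
reverses its sign. -/
lemma integral_mul_streamed_comm {g h : ℝ → ℝ} (hg : Measurable g) (hh : Measurable h)
    (hgi : Integrable g) (hhi : Integrable h) {M : ℝ} (hMg : ∀ t, |g t| ≤ M)
    (hMh : ∀ t, |h t| ≤ M) (μ : ℝ) :
    ∫ τ, g τ * streamed μ h τ = ∫ τ, h τ * streamed (-μ) g τ := by
  have hswap : ∀ {g h : ℝ → ℝ}, Measurable h → Integrable g → (∀ t, |h t| ≤ M) →
      ∀ μ, ∫ τ, g τ * streamed μ h τ =
        ∫ u in Ioi (0 : ℝ), ∫ τ, g τ * (Real.exp (-u) * h (τ - μ * u)) := by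
    intro g h hh hgi hM μ
    simp only [streamed, ← integral_const_mul]
    exact integral_integral_swap (integrable_mul_exp_neg_mul hh hgi hM μ)
  rw [hswap hh hgi hMh, hswap hg hhi hMg]
  refine integral_congr_ae (ae_of_all _ fun u => ?_)
  beta_reduce
  rw [← integral_add_right_eq_self _ (μ * u)]
  refine integral_congr_ae (ae_of_all _ fun τ => ?_)
  simp only [add_sub_cancel_right, neg_mul, sub_neg_eq_add]
  ring

/-- The operator of isotropic streaming is symmetric. -/
lemma integral_mul_integral_streamed_comm {g h : ℝ → ℝ} (hg : Measurable g) (hh : Measurable h)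
    (hgi : Integrable g) (hhi : Integrable h) {M : ℝ} (hMg : ∀ t, |g t| ≤ M)
    (hMh : ∀ t, |h t| ≤ M) :
    ∫ τ, g τ * (∫ θ in (-Real.pi)..Real.pi, streamed (Real.cos θ) h τ) =
      ∫ τ, h τ * (∫ θ in (-Real.pi)..Real.pi, streamed (Real.cos θ) g τ) := by
  have hswap : ∀ {g h : ℝ → ℝ}, Measurable h → Integrable g → (∀ t, |h t| ≤ M) →
      ∫ τ, g τ * (∫ θ in (-Real.pi)..Real.pi, streamed (Real.cos θ) h τ) =
        ∫ θ in (-Real.pi)..Real.pi, ∫ τ, g τ * streamed (Real.cos θ) h τ := by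
    intro g h hh hgi hM
    simp only [intervalIntegral.integral_of_le (neg_le_self Real.pi_pos.le), ← integral_const_mul]
    refine integral_integral_swap ?_
    refine ((hgi.comp_fst (volume.restrict (Ioc (-Real.pi) Real.pi))).mul_bdd (c := M)
      (g := fun p : ℝ × ℝ => streamed (Real.cos p.2) h p.1) ?_
      (ae_of_all _ fun _ => abs_streamed_le hM _ _))
    exact ((measurable_streamed hh).comp
      ((Real.measurable_cos.comp measurable_snd).prodMk measurable_fst)).aestronglyMeasurable
  rw [hswap hh hgi hMh, hswap hg hhi hMg]
  -- The sign change of the cosine becomes a shift of the angle by `π`, which is invisible to the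
  -- integral over a full period.
  simp only [integral_mul_streamed_comm hg hh hgi hhi hMg hMh, ← Real.cos_add_pi]
  set Q : ℝ → ℝ := fun θ => ∫ τ, h τ * streamed (Real.cos θ) g τ with hQ
  have hper : Function.Periodic Q (2 * Real.pi) := fun θ => by simp only [hQ, Real.cos_add_two_pi]
  have h1 := hper.intervalIntegral_add_eq 0 (-Real.pi)
  have h2 := intervalIntegral.integral_comp_add_right (a := -Real.pi) (b := Real.pi) Q Real.pi
  rw [show -Real.pi + 2 * Real.pi = Real.pi by ring, zero_add] at h1
  rw [neg_add_cancel, ← two_mul, h1] at h2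
  exact h2

/-! ### Solutions as streamed sources -/

/-- For `μ < 0` the factor `exp (-u)` is, up to a constant, the weight with `s = -1/μ` at `τ - μ u`.
For `μ > 0` the weight with `s = 1` becomes a multiple of `exp (μ u)`, which dominates `exp (-u)` on
`u > 0`. -/
lemma integrableOn_exp_neg_mul_comp {h : ℝ → ℝ}
    (hint : ∀ s : ℝ, 0 < s → Integrable fun t => Real.exp (-s * t) * h t)
    {μ : ℝ} (hμ : μ ≠ 0) (τ : ℝ) :
    IntegrableOn (fun u => Real.exp (-u) * h (τ - μ * u)) (Ioi 0) := by
  have hcomp : ∀ g : ℝ → ℝ, Integrable g → Integrable fun u => g (τ - μ * u) := fun g hg =>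
    (hg.comp_sub_left τ).comp_mul_left' hμ
  rcases hμ.lt_or_gt with hμ | hμ
  · have h1 := (hcomp _ (hint (-μ)⁻¹ (by simpa using hμ))).const_mul (Real.exp ((-μ)⁻¹ * τ))
    refine (h1.congr (ae_of_all _ fun u => ?_)).integrableOn
    simp only [← mul_assoc, ← Real.exp_add]
    congr 2
    field_simp
    ring
  · have h1 := (hcomp _ (hint 1 one_pos)).const_mul (Real.exp τ)
    have h2 : Integrable fun u => h (τ - μ * u) * Real.exp (μ * u) :=
      h1.congr (ae_of_all _ fun u => by
        simp only [← mul_assoc, ← Real.exp_add]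
        rw [mul_comm]
        congr 2
        ring)
    have h3 : AEStronglyMeasurable (fun u => Real.exp (-u) * h (τ - μ * u)) := by
      have h4 := h2.aestronglyMeasurable.mul
        (g := fun u => Real.exp (-(μ * u)) * Real.exp (-u)) (by fun_prop)
      refine h4.congr (ae_of_all _ fun u => ?_)
      have h5 : Real.exp (μ * u) * Real.exp (-(μ * u)) = 1 := by rw [← Real.exp_add]; simp
      simp only [Pi.mul_apply]
      linear_combination (h (τ - μ * u) * Real.exp (-u)) * h5
    refine Integrable.mono h2.integrableOn h3.restrict ?_
    refine (ae_restrict_iff' measurableSet_Ioi).2 (ae_of_all _ fun u (hu : 0 < u) => ?_)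
    rw [mul_comm, norm_mul, norm_mul]
    refine mul_le_mul_of_nonneg_left ?_ (norm_nonneg _)
    rw [Real.norm_eq_abs, Real.abs_exp, Real.norm_eq_abs, Real.abs_exp, Real.exp_le_exp]
    nlinarith

/-- The solution of `μ φ' + φ = S` which has a Laplace transform, and which vanishes at `0` when
`μ` is positive. -/
lemma eq_streamed_of_transport {μ : ℝ} (hμ : μ ≠ 0) {φ S : ℝ → ℝ}
    (hS : ∀ s : ℝ, 0 < s → IntegrableOn (fun t => Real.exp (-s * t) * S t) (Ioi 0))
    (hφ : ∀ s : ℝ, 0 < s → IntegrableOn (fun t => Real.exp (-s * t) * φ t) (Ioi 0))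
    (hd : ∀ τ, 0 < τ → DifferentiableAt ℝ φ τ) (hc : ContinuousWithinAt φ (Ici 0) 0)
    (htr : ∀ τ, 0 < τ → μ * deriv φ τ + φ τ = S τ) (h0 : 0 < μ → φ 0 = 0) {τ : ℝ} (hτ : 0 ≤ τ) :
    φ τ = streamed μ (indicator (Ioi 0) S) τ := by
  set h := indicator (Ioi 0) S with hh
  have hind : ∀ {g : ℝ → ℝ}, (∀ s : ℝ, 0 < s →
      IntegrableOn (fun t => Real.exp (-s * t) * g t) (Ioi 0)) → ∀ s : ℝ, 0 < s →
      Integrable fun t => Real.exp (-s * t) * indicator (Ioi 0) g t := fun {g} hg s hs => by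
    refine ((hg s hs).integrable_indicator measurableSet_Ioi).congr (ae_of_all _ fun t => ?_)
    by_cases ht : t ∈ Ioi (0 : ℝ) <;> simp [ht]
  have hz : ∀ {g : ℝ → ℝ}, ∀ t ≤ 0, indicator (Ioi 0) g t = 0 := fun {g} t ht =>
    indicator_of_notMem (by simpa using ht) g
  have hposS : ∀ {g : ℝ → ℝ} {t : ℝ}, 0 < t → indicator (Ioi 0) g t = g t := fun {g t} ht =>
    indicator_of_mem (mem_Ioi.2 ht) g
  have hintS : IntegrableOn (fun u => Real.exp (-u) * h (τ - μ * u)) (Ioi 0) :=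
    integrableOn_exp_neg_mul_comp (hind hS) hμ τ
  have hintφ : IntegrableOn (fun u => Real.exp (-u) * indicator (Ioi 0) φ (τ - μ * u)) (Ioi 0) :=
    integrableOn_exp_neg_mul_comp (hind hφ) hμ τ
  -- With the integrating factor `exp (-u)`, the transport equation is an exact derivative along the
  -- characteristic.
  have hder : ∀ u, 0 < τ - μ * u → HasDerivAt (fun u => -(Real.exp (-u) * φ (τ - μ * u)))
      (Real.exp (-u) * h (τ - μ * u)) u := fun u hu => by
    have h1 : HasDerivAt (fun u : ℝ => τ - μ * u) (-μ) u := by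
      simpa using ((hasDerivAt_id u).const_mul μ).const_sub τ
    have h2 := ((hd _ hu).hasDerivAt.comp u h1)
    have h3 := ((hasDerivAt_id u).neg.exp.mul h2).neg
    refine h3.congr_deriv ?_
    rw [hh, hposS hu, ← htr _ hu]
    simp only [id, Function.comp_apply, Pi.neg_apply]
    ring
  have hcont : ContinuousOn (fun u => -(Real.exp (-u) * φ (τ - μ * u))) {u | 0 ≤ τ - μ * u} := by
    have hφc : ContinuousOn φ (Ici 0) := fun t ht => by
      rcases (mem_Ici.1 ht).eq_or_lt with rfl | ht
      · exact hc
      · exact (hd t ht).continuousAt.continuousWithinAt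
    have h1 : ContinuousOn (fun u => φ (τ - μ * u)) {u | 0 ≤ τ - μ * u} :=
      hφc.comp (by fun_prop) fun u hu => hu
    exact (ContinuousOn.mul (by fun_prop) h1).neg
  rcases hμ.lt_or_gt with hneg | hpos
  -- The backward characteristic goes to infinite depth; the boundary term there vanishes because
  -- the primitive and its derivative are both integrable.
  · have hge : ∀ u, 0 < u → 0 < τ - μ * u := fun u hu => by nlinarith
    have hF : IntegrableOn (fun u => -(Real.exp (-u) * φ (τ - μ * u))) (Ioi 0) := by
      refine (hintφ.neg).congr_fun (fun u hu => ?_) measurableSet_Ioi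
      simp only [Pi.neg_apply]
      rw [hposS (hge u hu)]
    have hlim := tendsto_zero_of_hasDerivAt_of_integrableOn_Ioi
      (fun u hu => hder u (hge u hu)) hintS hF
    have hres := integral_Ioi_of_hasDerivAt_of_tendsto
      ((hcont 0 (by simpa using hτ)).mono fun u (hu : 0 ≤ u) => by
        simp only [mem_ofPred_eq]; nlinarith)
      (fun u hu => hder u (hge u hu)) hintS hlim
    rw [streamed, hres]
    simp
  -- The backward characteristic reaches the boundary at `u = τ / μ`, where `φ` vanishes; beyond it
  -- the source is cut off.
  · have hle : 0 ≤ τ / μ := by positivity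
    have hlt : ∀ u, u < τ / μ → 0 < τ - μ * u := fun u hu => by
      rw [lt_div_iff₀ hpos] at hu; linarith
    have hU : ∀ u, u ≤ τ / μ → 0 ≤ τ - μ * u := fun u hu => by
      rw [le_div_iff₀ hpos] at hu; linarith
    have hres := intervalIntegral.integral_eq_sub_of_hasDerivAt_of_le hle
      (hcont.mono fun u hu => hU u hu.2) (fun u hu => hder u (hlt u hu.2))
      ((intervalIntegrable_iff_integrableOn_Ioc_of_le hle).2 (hintS.mono_set Ioc_subset_Ioi_self))
    have htail : ∫ u in Ioi (τ / μ), Real.exp (-u) * h (τ - μ * u) = 0 :=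
      setIntegral_eq_zero_of_forall_eq_zero fun u (hu : τ / μ < u) => by
        rw [div_lt_iff₀ hpos] at hu
        rw [hh, hz _ (by linarith), mul_zero]
    rw [streamed, ← intervalIntegral.integral_interval_add_Ioi hintS
      (hintS.mono_set (Ioi_subset_Ioi hle)), htail, hres, mul_div_cancel₀ _ hμ]
    simp [h0 hpos]

/-! ### Weighted `L¹` estimates -/

/-- The Laplace transform of `|g|` at `s`, with value `∞` where it diverges. -/
noncomputable def absLaplace (s : ℝ) (g : ℝ → ℝ) : ENNReal :=
  ∫⁻ t in Ioi (0 : ℝ), ENNReal.ofReal (Real.exp (-s * t)) * ‖g t‖ₑ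

/-- By Tonelli and translation, path length `u` contributes `exp (-(1 + s μ) u)`, at most `exp (-(1
- s) u)`, whose integral is `1 / (1 - s)`. -/
lemma absLaplace_streamed_le {h : ℝ → ℝ} (hm : Measurable h) (h0 : ∀ t ≤ 0, h t = 0) {μ : ℝ}
    (hμ : -1 ≤ μ) {s : ℝ} (hs : 0 < s) (hs1 : s < 1) :
    absLaplace s (streamed μ h) ≤ ENNReal.ofReal (1 / (1 - s)) * absLaplace s h := by
  have hfull : absLaplace s h = ∫⁻ t, ENNReal.ofReal (Real.exp (-s * t)) * ‖h t‖ₑ := by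
    rw [absLaplace, ← lintegral_indicator measurableSet_Ioi]
    refine lintegral_congr fun t => ?_
    by_cases ht : 0 < t
    · rw [indicator_of_mem (mem_Ioi.2 ht)]
    · rw [indicator_of_notMem (by simpa using ht), h0 t (not_lt.1 ht)]; simp
  have hshift : ∀ u, ∫⁻ τ, ENNReal.ofReal (Real.exp (-s * τ)) * ‖Real.exp (-u) * h (τ - μ * u)‖ₑ =
      ENNReal.ofReal (Real.exp (-(1 + s * μ) * u)) * absLaplace s h := fun u => by
    rw [hfull, ← lintegral_const_mul' _ _ ENNReal.ofReal_ne_top,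
      ← lintegral_add_right_eq_self _ (μ * u)]
    refine lintegral_congr fun τ => ?_
    rw [add_sub_cancel_right, enorm_mul, Real.enorm_of_nonneg (Real.exp_pos _).le, ← mul_assoc,
      ← mul_assoc, ← ENNReal.ofReal_mul (Real.exp_pos _).le,
      ← ENNReal.ofReal_mul (Real.exp_pos _).le, ← Real.exp_add, ← Real.exp_add]
    congr 3
    ring
  calc absLaplace s (streamed μ h)
      ≤ ∫⁻ τ, ENNReal.ofReal (Real.exp (-s * τ)) *
          ∫⁻ u in Ioi (0 : ℝ), ‖Real.exp (-u) * h (τ - μ * u)‖ₑ := by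
        refine (setLIntegral_le_lintegral _ _).trans (lintegral_mono fun τ => ?_)
        exact mul_le_mul_right (enorm_integral_le_lintegral_enorm _) _
    _ = ∫⁻ τ, ∫⁻ u in Ioi (0 : ℝ), ENNReal.ofReal (Real.exp (-s * τ)) *
          ‖Real.exp (-u) * h (τ - μ * u)‖ₑ := by
        refine lintegral_congr fun τ => ?_
        rw [lintegral_const_mul' _ _ ENNReal.ofReal_ne_top]
    _ = ∫⁻ u in Ioi (0 : ℝ), ENNReal.ofReal (Real.exp (-(1 + s * μ) * u)) * absLaplace s h := by
        rw [lintegral_lintegral_swap (by simp only [Function.uncurry_def]; fun_prop)]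
        exact lintegral_congr hshift
    _ ≤ ∫⁻ u in Ioi (0 : ℝ), ENNReal.ofReal (Real.exp (-(1 - s) * u)) * absLaplace s h := by
        refine setLIntegral_mono (by fun_prop) fun u (hu : 0 < u) => ?_
        gcongr
        nlinarith
    _ = ENNReal.ofReal (1 / (1 - s)) * absLaplace s h := by
        rw [lintegral_mul_const _ (by fun_prop), ← ofReal_integral_eq_lintegral_ofReal
          (integrableOn_exp_mul_Ioi (by linarith) 0) (ae_of_all _ fun u => (Real.exp_pos _).le),
          integral_exp_mul_Ioi (by linarith)]
        rw [mul_zero, Real.exp_zero, neg_div_neg_eq]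

lemma streamed_congr_ae {g h : ℝ → ℝ} (hgh : g =ᵐ[volume] h) {μ : ℝ} (hμ : μ ≠ 0) (τ : ℝ) :
    streamed μ g τ = streamed μ h τ := by
  have h1 : Measure.QuasiMeasurePreserving (fun u : ℝ => μ * u) volume volume :=
    ⟨by fun_prop, by
      rw [Real.map_volume_mul_left hμ]
      exact Measure.smul_absolutelyContinuous⟩
  have h2 := ((quasiMeasurePreserving_sub_left volume τ).comp h1).ae hgh
  refine integral_congr_ae (ae_restrict_of_ae ?_)
  filter_upwards [h2] with u hu
  exact congrArg _ hu

lemma absLaplace_congr {s : ℝ} {g h : ℝ → ℝ} (hgh : g =ᵐ[volume.restrict (Ioi 0)] h) :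
    absLaplace s g = absLaplace s h :=
  lintegral_congr_ae (by filter_upwards [hgh] with t ht; rw [ht])

lemma absLaplace_lt_top {s : ℝ} {g : ℝ → ℝ}
    (hg : IntegrableOn (fun t => Real.exp (-s * t) * g t) (Ioi 0)) : absLaplace s g < ⊤ := by
  refine lt_of_eq_of_lt (lintegral_congr fun t => ?_) hg.hasFiniteIntegral
  rw [enorm_mul, Real.enorm_of_nonneg (Real.exp_pos _).le]

lemma aemeasurable_of_laplace {s : ℝ} {g : ℝ → ℝ}
    (hg : IntegrableOn (fun t => Real.exp (-s * t) * g t) (Ioi 0)) :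
    AEMeasurable g (volume.restrict (Ioi 0)) := by
  have h1 := hg.aestronglyMeasurable.aemeasurable.mul
    (g := fun t => Real.exp (s * t)) (by fun_prop)
  refine h1.congr (ae_of_all _ fun t => ?_)
  have h2 : Real.exp (-s * t) * Real.exp (s * t) = 1 := by rw [← Real.exp_add]; simp
  simp only [Pi.mul_apply]
  linear_combination g t * h2

/-- The source density is bounded in the weighted `L¹` norms by the inhomogeneity. -/
lemma absLaplace_source_le {ω : ℝ} (hω₀ : 0 ≤ ω) {S F : ℝ → ℝ} {ψ : ℝ → ℝ → ℝ}
    (hF : Measurable F)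
    (hS : ∀ s : ℝ, 0 < s → IntegrableOn (fun t => Real.exp (-s * t) * S t) (Ioi 0))
    (hψ : ∀ θ ∈ Ioc (-Real.pi) Real.pi, Real.cos θ ≠ 0 → ∀ τ, 0 < τ →
      ψ θ τ = streamed (Real.cos θ) (indicator (Ioi 0) S) τ)
    (hSF : ∀ τ, 0 < τ →
      S τ = ω / (2 * Real.pi) * (∫ θ in (-Real.pi)..Real.pi, ψ θ τ) + F τ)
    {s : ℝ} (hs : 0 < s) (hsω : s ≤ (1 - ω) / 2) :
    absLaplace s S ≤ ENNReal.ofReal ((1 + ω) / (1 - ω)) * absLaplace s F := by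
  have hπ := Real.pi_pos
  have hs1 : s < 1 := by linarith
  set a := ω / (2 * Real.pi) with ha
  have ha0 : 0 ≤ a := by positivity
  -- Tonelli is applied to a measurable representative; off the grazing directions streaming does
  -- not see the change.
  obtain ⟨S', hS'm, hSS'⟩ := aemeasurable_of_laplace (hS 1 one_pos)
  set h := indicator (Ioi 0) S' with hh
  have hm : Measurable h := hS'm.indicator measurableSet_Ioi
  have h0 : ∀ t ≤ 0, h t = 0 := fun t ht => indicator_of_notMem (by simpa using ht) S'
  have hSh : indicator (Ioi 0) S =ᵐ[volume] h :=
    (ae_eq_restrict_iff_indicator_ae_eq measurableSet_Ioi).1 hSS'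
  have hN : absLaplace s h = absLaplace s S := by
    refine absLaplace_congr ?_
    filter_upwards [hSS', ae_restrict_mem measurableSet_Ioi] with t ht htm
    rw [hh, indicator_of_mem htm, ht]
  have hpt : ∀ τ, 0 < τ → ‖S τ‖ₑ ≤ ENNReal.ofReal a *
      (∫⁻ θ in Ioc (-Real.pi) Real.pi, ‖streamed (Real.cos θ) h τ‖ₑ) + ‖F τ‖ₑ := fun τ hτ => by
    have h1 : ∫ θ in (-Real.pi)..Real.pi, ψ θ τ =
        ∫ θ in Ioc (-Real.pi) Real.pi, streamed (Real.cos θ) h τ := by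
      rw [intervalIntegral.integral_of_le (neg_le_self hπ.le)]
      refine integral_congr_ae ?_
      filter_upwards [ae_restrict_of_ae ae_cos_ne_zero, ae_restrict_mem measurableSet_Ioc]
        with θ hθ hθm
      rw [hψ θ hθm hθ τ hτ, streamed_congr_ae hSh hθ]
    rw [hSF τ hτ, h1]
    refine (enorm_add_le _ _).trans ?_
    rw [enorm_mul, Real.enorm_of_nonneg ha0]
    gcongr
    exact enorm_integral_le_lintegral_enorm _
  have hmeas : Measurable fun p : ℝ × ℝ => ENNReal.ofReal (Real.exp (-s * p.1)) *
      ‖streamed (Real.cos p.2) h p.1‖ₑ := by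
    have := (measurable_streamed hm).comp
      ((Real.measurable_cos.comp measurable_snd).prodMk (measurable_fst (α := ℝ) (β := ℝ)))
    exact Measurable.mul (by fun_prop) this.enorm
  -- The factor obtained is `ω / (1 - s)`; `s ≤ (1 - ω) / 2` bounds it by `2ω / (1 + ω) < 1`,
  -- independently of `s`.
  have hmain : absLaplace s S ≤ ENNReal.ofReal (2 * ω / (1 + ω)) * absLaplace s S +
      absLaplace s F := by
    calc absLaplace s S ≤ ∫⁻ τ in Ioi (0 : ℝ), (ENNReal.ofReal a *
          (∫⁻ θ in Ioc (-Real.pi) Real.pi, ENNReal.ofReal (Real.exp (-s * τ)) *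
            ‖streamed (Real.cos θ) h τ‖ₑ) + ENNReal.ofReal (Real.exp (-s * τ)) * ‖F τ‖ₑ) := by
          refine lintegral_mono_ae ?_
          filter_upwards [ae_restrict_mem measurableSet_Ioi] with τ hτ
          rw [lintegral_const_mul' _ _ ENNReal.ofReal_ne_top, mul_left_comm, ← mul_add]
          exact mul_le_mul_right (hpt τ hτ) _
      _ = ENNReal.ofReal a * (∫⁻ θ in Ioc (-Real.pi) Real.pi,
            absLaplace s (streamed (Real.cos θ) h)) + absLaplace s F := by
          rw [lintegral_add_right _ (by fun_prop), lintegral_const_mul' _ _ ENNReal.ofReal_ne_top,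
            lintegral_lintegral_swap hmeas.aemeasurable]
          rfl
      _ ≤ ENNReal.ofReal a * (∫⁻ θ in Ioc (-Real.pi) Real.pi,
            ENNReal.ofReal (1 / (1 - s)) * absLaplace s S) + absLaplace s F := by
          gcongr with θ
          rw [← hN]
          exact absLaplace_streamed_le hm h0 (Real.neg_one_le_cos θ) hs hs1
      _ ≤ _ := by
          rw [setLIntegral_const, Real.volume_Ioc, mul_right_comm _ _ (ENNReal.ofReal _),
            ← mul_assoc, ← ENNReal.ofReal_mul (by positivity), ← ENNReal.ofReal_mul ha0]
          gcongr
          rw [ha, show ω / (2 * Real.pi) * (1 / (1 - s) * (Real.pi - -Real.pi)) = ω / (1 - s) by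
            have : 1 - s ≠ 0 := by linarith
            field_simp; ring]
          rw [div_le_div_iff₀ (by linarith) (by linarith)]
          nlinarith
  -- Finiteness allows the term on the right to be absorbed into the left side.
  have hfin : absLaplace s S ≠ ⊤ := (absLaplace_lt_top (hS s hs)).ne
  have hω : 1 - ω ≠ 0 := by linarith
  have hω' : 1 + ω ≠ 0 := by linarith
  have hsplit : absLaplace s S = ENNReal.ofReal (2 * ω / (1 + ω)) * absLaplace s S +
      ENNReal.ofReal ((1 - ω) / (1 + ω)) * absLaplace s S := by
    rw [← add_mul, ← ENNReal.ofReal_add (by positivity)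
      (div_nonneg (by linarith) (by linarith)), show 2 * ω / (1 + ω) + (1 - ω) / (1 + ω) = 1 by
        field_simp; ring]
    simp
  have hle : ENNReal.ofReal ((1 - ω) / (1 + ω)) * absLaplace s S ≤ absLaplace s F := by
    exact (ENNReal.add_le_add_iff_left (ENNReal.mul_ne_top ENNReal.ofReal_ne_top hfin)).1
      (hsplit.ge.trans hmain)
  calc absLaplace s S = ENNReal.ofReal ((1 + ω) / (1 - ω)) *
        (ENNReal.ofReal ((1 - ω) / (1 + ω)) * absLaplace s S) := by
        rw [← mul_assoc, ← ENNReal.ofReal_mul (div_nonneg (by linarith) (by linarith)),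
          show (1 + ω) / (1 - ω) * ((1 - ω) / (1 + ω)) = 1 by field_simp]
        simp
    _ ≤ _ := mul_le_mul_right hle _

lemma ae_eq_zero_of_absLaplace_eq_zero {s : ℝ} {g : ℝ → ℝ}
    (hg : AEMeasurable g (volume.restrict (Ioi 0))) (h0 : absLaplace s g = 0) :
    g =ᵐ[volume.restrict (Ioi 0)] 0 := by
  have h1 := (lintegral_eq_zero_iff' (by fun_prop)).1 h0
  filter_upwards [h1] with t ht
  simpa [(Real.exp_pos _).not_ge] using ht

/-- Fatou's lemma along a sequence `s → 0`, on which the weights tend to `1`. -/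
lemma integrableOn_of_absLaplace_le {g : ℝ → ℝ} (hg : AEMeasurable g (volume.restrict (Ioi 0)))
    {s₀ : ℝ} (hs₀ : 0 < s₀) {C : ENNReal} (hC : C < ⊤)
    (hle : ∀ s, 0 < s → s ≤ s₀ → absLaplace s g ≤ C) : IntegrableOn g (Ioi 0) := by
  refine ⟨hg.aestronglyMeasurable, lt_of_le_of_lt ?_ hC⟩
  have hlim : Filter.Tendsto (fun n : ℕ => s₀ * (1 / ((n : ℝ) + 1))) Filter.atTop (nhds 0) := by
    simpa using tendsto_one_div_add_atTop_nhds_zero_nat.const_mul s₀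
  have hpt : ∀ t, Filter.Tendsto (fun n : ℕ => ENNReal.ofReal
      (Real.exp (-(s₀ * (1 / ((n : ℝ) + 1))) * t)) * ‖g t‖ₑ) Filter.atTop (nhds ‖g t‖ₑ) :=
    fun t => by
      have h1 : Filter.Tendsto (fun n : ℕ => Real.exp (-(s₀ * (1 / ((n : ℝ) + 1))) * t))
          Filter.atTop (nhds 1) := by
        have := (Real.continuous_exp.tendsto _).comp (hlim.neg.mul_const t)
        simpa [Function.comp_def] using this
      have h2 := ENNReal.Tendsto.mul_const (b := ‖g t‖ₑ) (ENNReal.tendsto_ofReal h1)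
        (Or.inr enorm_ne_top)
      simpa using h2
  calc ∫⁻ t in Ioi (0 : ℝ), ‖g t‖ₑ
      = ∫⁻ t in Ioi (0 : ℝ), Filter.liminf (fun n : ℕ => ENNReal.ofReal
          (Real.exp (-(s₀ * (1 / ((n : ℝ) + 1))) * t)) * ‖g t‖ₑ) Filter.atTop :=
        lintegral_congr fun t => (hpt t).liminf_eq.symm
    _ ≤ Filter.liminf (fun n : ℕ => absLaplace (s₀ * (1 / ((n : ℝ) + 1))) g) Filter.atTop :=
        lintegral_liminf_le' fun n => by fun_prop
    _ ≤ C := by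
        refine Filter.liminf_le_of_frequently_le' (Filter.Frequently.of_forall fun n => ?_)
        refine hle _ (by positivity) (mul_le_of_le_one_right hs₀.le ?_)
        rw [div_le_one (by positivity)]
        linarith [(Nat.cast_nonneg n : (0 : ℝ) ≤ n)]

/-! ### Uniqueness and integrability of the source density -/

/-- The right-hand side of the transport equation. -/
noncomputable def sourceDensity (ω θ₀ : ℝ) (ψ : ℝ → ℝ → ℝ) (τ : ℝ) : ℝ :=
  ω / (2 * Real.pi) * (∫ θ' in (-Real.pi)..Real.pi, ψ θ' τ)
    + ω / (2 * Real.pi) * Real.exp (-τ / Real.cos θ₀)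

lemma integrableOn_exp_neg_div {μ₀ : ℝ} (hμ₀ : 0 < μ₀) :
    IntegrableOn (fun τ => Real.exp (-τ / μ₀)) (Ioi 0) := by
  have h1 := integrableOn_exp_mul_Ioi (a := -μ₀⁻¹) (by simpa using hμ₀) 0
  refine h1.congr_fun (fun τ _ => ?_) measurableSet_Ioi
  simp only
  congr 1
  ring

lemma abs_le_pi_div_two_of_cos_pos {θ : ℝ} (hθ : θ ∈ Ioc (-Real.pi) Real.pi)
    (h : 0 < Real.cos θ) : |θ| ≤ Real.pi / 2 := by
  by_contra! hc
  have h1 := Real.cos_nonpos_of_pi_div_two_le_of_le hc.le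
    ((abs_le.2 ⟨hθ.1.le, hθ.2⟩).trans (by linarith [Real.pi_pos]))
  rw [Real.cos_abs] at h1
  linarith

lemma cos_neg_of_pi_div_two_lt_abs {θ : ℝ} (hθ : θ ∈ Ioc (-Real.pi) Real.pi)
    (h : Real.pi / 2 < |θ|) : Real.cos θ < 0 := by
  rw [← Real.cos_abs]
  exact Real.cos_neg_of_pi_div_two_lt_of_lt h
    ((abs_le.2 ⟨hθ.1.le, hθ.2⟩).trans_lt (by linarith [Real.pi_pos]))

namespace IsDiffuseFlux

variable {ω θ₀ θ₁ : ℝ} {ψ φ : ℝ → ℝ → ℝ}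

lemma laplace_source (hψ : IsDiffuseFlux ω θ₀ ψ) (hθ₀ : 0 < Real.cos θ₀) (s : ℝ) (hs : 0 < s) :
    IntegrableOn (fun τ => Real.exp (-s * τ) * sourceDensity ω θ₀ ψ τ) (Ioi 0) := by
  have h1 := hψ.laplace_joint s hs
  rw [IntegrableOn, Measure.volume_eq_prod, ← Measure.prod_restrict] at h1
  have h2 := (h1.integral_prod_right).const_mul (ω / (2 * Real.pi))
  have h3 : IntegrableOn (fun τ => Real.exp (-s * τ) * Real.exp (-τ / Real.cos θ₀)) (Ioi 0) := by
    refine (integrableOn_exp_neg_div hθ₀).bdd_mul (c := 1)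
      (f := fun τ => Real.exp (-s * τ)) (by fun_prop) ?_
    filter_upwards [ae_restrict_mem measurableSet_Ioi] with τ hτ
    rw [Real.norm_eq_abs, Real.abs_exp, Real.exp_le_one_iff]
    have : 0 < s * τ := mul_pos hs hτ
    linarith
  refine (h2.add (h3.const_mul (ω / (2 * Real.pi)))).congr (ae_of_all _ fun τ => ?_)
  simp only [Pi.add_apply, sourceDensity, integral_const_mul,
    intervalIntegral.integral_of_le (neg_le_self Real.pi_pos.le)]
  ring

lemma eq_streamed (hψ : IsDiffuseFlux ω θ₀ ψ) (hθ₀ : 0 < Real.cos θ₀) {θ : ℝ}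
    (hθ : θ ∈ Ioc (-Real.pi) Real.pi) (hμ : Real.cos θ ≠ 0) {τ : ℝ} (hτ : 0 ≤ τ) :
    ψ θ τ = streamed (Real.cos θ) (indicator (Ioi 0) (sourceDensity ω θ₀ ψ)) τ :=
  eq_streamed_of_transport hμ (hψ.laplace_source hθ₀) (hψ.laplace θ hθ)
    (hψ.differentiable θ hθ hμ) (hψ.continuous_zero θ hθ hμ) (hψ.transport θ hθ)
    (fun h => hψ.no_reentrant θ (abs_le_pi_div_two_of_cos_pos hθ h)) hτ

/-- The emergent flux is a Laplace transform of the source density. -/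
lemma emergent (hψ : IsDiffuseFlux ω θ₀ ψ) (hθ₀ : 0 < Real.cos θ₀) {θ : ℝ}
    (hθ : θ ∈ Ioc (-Real.pi) Real.pi) (hμ : Real.cos θ < 0) :
    ψ θ 0 = -(Real.cos θ)⁻¹ *
      ∫ t in Ioi 0, Real.exp (-t / -Real.cos θ) * sourceDensity ω θ₀ ψ t := by
  rw [hψ.eq_streamed hθ₀ hθ hμ.ne le_rfl, streamed]
  have h1 := integral_comp_mul_left_Ioi
    (fun t => Real.exp (-t / -Real.cos θ) * sourceDensity ω θ₀ ψ t) 0 (neg_pos.2 hμ)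
  rw [mul_zero, smul_eq_mul, inv_neg] at h1
  rw [← h1]
  refine setIntegral_congr_fun measurableSet_Ioi fun u (hu : 0 < u) => ?_
  have h2 : 0 < -Real.cos θ * u := mul_pos (neg_pos.2 hμ) hu
  rw [zero_sub, ← neg_mul, indicator_of_mem (mem_Ioi.2 h2)]
  congr 2
  have := hμ.ne
  field_simp

/-- The source density depends on the incident direction through its cosine only. -/
lemma source_ae_eq (hω₀ : 0 ≤ ω) (hω₁ : ω < 1) (hψ : IsDiffuseFlux ω θ₀ ψ)
    (hφ : IsDiffuseFlux ω θ₁ φ) (hθ₀ : 0 < Real.cos θ₀) (hcos : Real.cos θ₁ = Real.cos θ₀) :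
    sourceDensity ω θ₀ ψ =ᵐ[volume.restrict (Ioi 0)] sourceDensity ω θ₁ φ := by
  have hθ₁ : 0 < Real.cos θ₁ := hcos ▸ hθ₀
  set S : ℝ → ℝ := fun τ => sourceDensity ω θ₀ ψ τ - sourceDensity ω θ₁ φ τ with hSdef
  have hS : ∀ s : ℝ, 0 < s → IntegrableOn (fun t => Real.exp (-s * t) * S t) (Ioi 0) :=
    fun s hs => ((hψ.laplace_source hθ₀ s hs).sub (hφ.laplace_source hθ₁ s hs)).congr
      (ae_of_all _ fun t => by simp only [Pi.sub_apply, hSdef]; ring)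
  have hdiff : ∀ θ ∈ Ioc (-Real.pi) Real.pi, Real.cos θ ≠ 0 → ∀ τ, 0 < τ →
      ψ θ τ - φ θ τ = streamed (Real.cos θ) (indicator (Ioi 0) S) τ := fun θ hθ hμ τ hτ => by
    refine eq_streamed_of_transport (φ := fun τ => ψ θ τ - φ θ τ) hμ hS (fun s hs => ?_)
      (fun τ hτ => (hψ.differentiable θ hθ hμ τ hτ).sub (hφ.differentiable θ hθ hμ τ hτ))
      ((hψ.continuous_zero θ hθ hμ).sub (hφ.continuous_zero θ hθ hμ)) (fun τ hτ => ?_)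
      (fun h => ?_) hτ.le
    · exact ((hψ.laplace θ hθ s hs).sub (hφ.laplace θ hθ s hs)).congr
        (ae_of_all _ fun t => by simp only [Pi.sub_apply]; ring)
    · rw [deriv_fun_sub (hψ.differentiable θ hθ hμ τ hτ) (hφ.differentiable θ hθ hμ τ hτ)]
      have h1 := hψ.transport θ hθ τ hτ
      have h2 := hφ.transport θ hθ τ hτ
      simp only [hSdef, sourceDensity]
      linear_combination h1 - h2
    · have h1 := abs_le_pi_div_two_of_cos_pos hθ h
      rw [hψ.no_reentrant θ h1, hφ.no_reentrant θ h1, sub_zero]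
  -- Equal cosines cancel the inhomogeneities, so the difference of the sources satisfies the
  -- homogeneous equation.
  have hle := absLaplace_source_le hω₀ (F := fun _ => 0) (ψ := fun θ τ => ψ θ τ - φ θ τ)
    measurable_const hS hdiff (fun τ hτ => by
      rw [intervalIntegral.integral_sub (hψ.integrable_angle τ hτ) (hφ.integrable_angle τ hτ)]
      simp only [hSdef, sourceDensity, hcos]
      ring) (s := (1 - ω) / 2) (by linarith) le_rfl
  have hz : absLaplace ((1 - ω) / 2) S = 0 := by
    refine le_antisymm (hle.trans ?_) bot_le
    simp [absLaplace]
  filter_upwards [ae_eq_zero_of_absLaplace_eq_zero (aemeasurable_of_laplace (hS 1 one_pos)) hz]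
    with t ht
  exact sub_eq_zero.1 ht

/-- The weighted norms of the inhomogeneity are at most its plain `L¹` norm, so the bound on the
source survives `s → 0`. -/
lemma integrableOn_source (hω₀ : 0 ≤ ω) (hω₁ : ω < 1) (hψ : IsDiffuseFlux ω θ₀ ψ)
    (hθ₀ : 0 < Real.cos θ₀) : IntegrableOn (sourceDensity ω θ₀ ψ) (Ioi 0) := by
  have hF : IntegrableOn (fun τ => ω / (2 * Real.pi) * Real.exp (-τ / Real.cos θ₀)) (Ioi 0) :=
    (integrableOn_exp_neg_div hθ₀).const_mul _
  refine integrableOn_of_absLaplace_le (aemeasurable_of_laplace (hψ.laplace_source hθ₀ 1 one_pos))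
    (s₀ := (1 - ω) / 2) (by linarith)
    (ENNReal.mul_lt_top (ENNReal.ofReal_lt_top (r := (1 + ω) / (1 - ω))) hF.hasFiniteIntegral)
    fun s hs hsω => ?_
  refine (absLaplace_source_le hω₀ (by fun_prop) (hψ.laplace_source hθ₀)
    (fun θ hθ hμ τ hτ => hψ.eq_streamed hθ₀ hθ hμ hτ.le) (fun τ _ => rfl) hs hsω).trans ?_
  refine mul_le_mul_right (setLIntegral_mono_ae (by fun_prop) (ae_of_all _ fun t ht => ?_)) _
  refine mul_le_of_le_one_left bot_le ?_
  rw [← ENNReal.ofReal_one]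
  refine ENNReal.ofReal_le_ofReal (Real.exp_le_one_iff.2 ?_)
  have : 0 < s * t := mul_pos hs ht
  linarith

end IsDiffuseFlux

/-! ### Reciprocity and the reflection function -/

lemma exists_isDiffuseFlux_source_eq {ω : ℝ} (hω₀ : 0 ≤ ω) (hω₁ : ω < 1) {θ₀ : ℝ}
    (hθ₀ : 0 < Real.cos θ₀) :
    ∃ (ψ : ℝ → ℝ → ℝ) (f : ℝ → ℝ) (M : ℝ), IsDiffuseFlux ω θ₀ ψ ∧ Continuous f ∧
      (∀ t, |f t| ≤ M) ∧ (∀ τ, 0 < τ → sourceDensity ω θ₀ ψ τ = f τ) ∧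
      ψ = fun θ τ => streamed (Real.cos θ) (indicator (Ioi 0) f) τ := by
  obtain ⟨f, hf⟩ := exists_source hω₀ hω₁ hθ₀
  refine ⟨_, f, ‖f‖, isDiffuseFlux_streamed f.continuous f.norm_coe_le_norm hf, f.continuous,
    f.norm_coe_le_norm, fun τ hτ => ?_, rfl⟩
  rw [hf τ, abs_of_pos hτ, sourceDensity]

/-- Reciprocity for the Laplace transforms of the source densities. -/
lemma integral_exp_mul_source_comm {ω : ℝ} (hω₀ : 0 ≤ ω) (hω₁ : ω < 1) {θ₁ θ₂ : ℝ}
    (hθ₁ : 0 < Real.cos θ₁) (hθ₂ : 0 < Real.cos θ₂) :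
    ∃ ψ φ : ℝ → ℝ → ℝ, IsDiffuseFlux ω θ₁ ψ ∧ IsDiffuseFlux ω θ₂ φ ∧
      ∫ t in Ioi 0, Real.exp (-t / Real.cos θ₁) * sourceDensity ω θ₂ φ t =
        ∫ t in Ioi 0, Real.exp (-t / Real.cos θ₂) * sourceDensity ω θ₁ ψ t := by
  obtain ⟨ψ, f, A, hψ, hfc, hfA, hfS, hψf⟩ := exists_isDiffuseFlux_source_eq hω₀ hω₁ hθ₁
  obtain ⟨φ, g, B, hφ, hgc, hgB, hgS, hφg⟩ := exists_isDiffuseFlux_source_eq hω₀ hω₁ hθ₂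
  refine ⟨ψ, φ, hψ, hφ, ?_⟩
  -- The argument ends by cancelling `a`; for `ω = 0` both sources vanish instead.
  rcases hω₀.eq_or_lt with rfl | hω
  · simp [sourceDensity]
  have ha : ω / (2 * Real.pi) ≠ 0 := by have := Real.pi_pos; positivity
  set a := ω / (2 * Real.pi) with hadef
  have hfi : IntegrableOn f (Ioi 0) :=
    (hψ.integrableOn_source hω₀ hω₁ hθ₁).congr_fun (fun τ hτ => hfS τ hτ) measurableSet_Ioi
  have hgi : IntegrableOn g (Ioi 0) :=
    (hφ.integrableOn_source hω₀ hω₁ hθ₂).congr_fun (fun τ hτ => hgS τ hτ) measurableSet_Ioi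
  have hbd : ∀ {k : ℝ → ℝ} {C : ℝ}, (∀ t, |k t| ≤ C) → C ≤ max A B →
      ∀ t, |indicator (Ioi 0) k t| ≤ max A B := fun {k C} hk hC t =>
    (norm_indicator_le_norm_self (s := Ioi 0) k t).trans ((hk t).trans hC)
  have hcomm := integral_mul_integral_streamed_comm (M := max A B)
    (hgc.measurable.indicator measurableSet_Ioi) (hfc.measurable.indicator measurableSet_Ioi)
    (hgi.integrable_indicator measurableSet_Ioi) (hfi.integrable_indicator measurableSet_Ioi)
    (hbd hgB (le_max_right _ _)) (hbd hfA (le_max_left _ _))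
  -- The integral equation for `k` paired with `l`: `a ⟨l, K k⟩ = ⟨l, k⟩ - a ⟨E, l⟩`.
  have hred : ∀ {θ : ℝ} {χ : ℝ → ℝ → ℝ} {k l : ℝ → ℝ} {C : ℝ}, 0 < Real.cos θ →
      (∀ τ, 0 < τ → sourceDensity ω θ χ τ = k τ) → Continuous k → (∀ t, |k t| ≤ C) →
      χ = (fun θ τ => streamed (Real.cos θ) (indicator (Ioi 0) k) τ) → IntegrableOn l (Ioi 0) →
      a * ∫ τ, indicator (Ioi 0) l τ *
          (∫ θ in (-Real.pi)..Real.pi, streamed (Real.cos θ) (indicator (Ioi 0) k) τ) =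
        (∫ t in Ioi 0, l t * k t) - a * ∫ t in Ioi 0, Real.exp (-t / Real.cos θ) * l t := by
    intro θ χ k l C hθ hS hc hC hχ hl
    have h1 : IntegrableOn (fun t => l t * k t) (Ioi 0) :=
      hl.mul_bdd (c := C) hc.aestronglyMeasurable (ae_of_all _ hC)
    have h2 : IntegrableOn (fun t => Real.exp (-t / Real.cos θ) * l t) (Ioi 0) := by
      refine Integrable.bdd_mul (c := 1) hl (by fun_prop) ?_
      filter_upwards [ae_restrict_mem measurableSet_Ioi] with τ hτ
      rw [Real.norm_eq_abs, Real.abs_exp, Real.exp_le_one_iff]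
      exact div_nonpos_of_nonpos_of_nonneg (neg_nonpos.2 (le_of_lt hτ)) hθ.le
    rw [← integral_const_mul, ← integral_const_mul, ← integral_sub h1 (h2.const_mul a),
      ← integral_indicator measurableSet_Ioi]
    refine integral_congr_ae (ae_of_all _ fun τ => ?_)
    by_cases hτ : τ ∈ Ioi (0 : ℝ)
    · have h3 := hS τ hτ
      simp only [sourceDensity, hχ] at h3
      simp only [indicator_of_mem hτ]
      linear_combination l τ * h3
    · simp only [indicator_of_notMem hτ, zero_mul, mul_zero]
  have h1 := hred hθ₁ hfS hfc hfA hψf hgi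
  have h2 := hred hθ₂ hgS hgc hgB hφg hfi
  rw [hcomm, h2] at h1
  have h3 : ∫ t in Ioi 0, f t * g t = ∫ t in Ioi 0, g t * f t := by simp only [mul_comm]
  have h4 : ∀ {θ : ℝ} {k l : ℝ → ℝ}, (∀ τ, 0 < τ → k τ = l τ) →
      ∫ t in Ioi 0, Real.exp (-t / Real.cos θ) * k t =
        ∫ t in Ioi 0, Real.exp (-t / Real.cos θ) * l t := fun {θ k l} hkl =>
    setIntegral_congr_fun measurableSet_Ioi fun t ht => by simp only [hkl t ht]
  rw [h4 hfS, h4 hgS]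
  rw [h3] at h1
  exact mul_left_cancel₀ ha (by linarith)

lemma IsDiffuseReflection.eq_integral {ω : ℝ} {D : ℝ → ℝ → ℝ} (hD : IsDiffuseReflection ω D)
    {θ₀ : ℝ} (hθ₀ : θ₀ ∈ Ioo (-(Real.pi / 2)) (Real.pi / 2)) {ψ : ℝ → ℝ → ℝ}
    (hψ : IsDiffuseFlux ω θ₀ ψ) {θ : ℝ} (hθ : θ ∈ Ioc (-Real.pi) Real.pi)
    (hθ' : Real.pi / 2 < |θ|) :
    D (-Real.cos θ) (Real.cos θ₀) =
      ∫ t in Ioi 0, Real.exp (-t / -Real.cos θ) * sourceDensity ω θ₀ ψ t := by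
  have hμ := cos_neg_of_pi_div_two_lt_abs hθ hθ'
  have h1 := hD θ₀ hθ₀ ψ hψ θ hθ hθ'
  rw [hψ.emergent (Real.cos_pos_of_mem_Ioo hθ₀) hθ hμ] at h1
  exact (mul_left_cancel₀ (neg_ne_zero.2 (inv_ne_zero hμ.ne)) h1).symm

/-- A source is chosen for each incident cosine; by `source_ae_eq` the choice serves all incident
angles with that cosine and all their solutions. -/
lemma exists_isDiffuseReflection {ω : ℝ} (hω₀ : 0 ≤ ω) (hω₁ : ω < 1) :
    ∃ D : ℝ → ℝ → ℝ, IsDiffuseReflection ω D := by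
  classical
  have hex : ∀ m₀ : ℝ, ∃ S : ℝ → ℝ, ∀ θ₀, 0 < Real.cos θ₀ → Real.cos θ₀ = m₀ → ∀ ψ,
      IsDiffuseFlux ω θ₀ ψ → sourceDensity ω θ₀ ψ =ᵐ[volume.restrict (Ioi 0)] S := by
    intro m₀
    by_cases h : ∃ θ₁ φ, 0 < Real.cos θ₁ ∧ Real.cos θ₁ = m₀ ∧ IsDiffuseFlux ω θ₁ φ
    · obtain ⟨θ₁, φ, -, hm, hφ⟩ := h
      exact ⟨sourceDensity ω θ₁ φ, fun θ₀ h0 h1 ψ hψ =>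
        hψ.source_ae_eq hω₀ hω₁ hφ h0 (hm.trans h1.symm)⟩
    · exact ⟨0, fun θ₀ h0 h1 ψ hψ => (h ⟨θ₀, ψ, h0, h1, hψ⟩).elim⟩
  choose S hS using hex
  refine ⟨fun m m₀ => ∫ t in Ioi 0, Real.exp (-t / m) * S m₀ t, fun θ₀ hθ₀ ψ hψ θ hθ hθ' => ?_⟩
  have h0 := Real.cos_pos_of_mem_Ioo hθ₀
  rw [hψ.emergent h0 hθ (cos_neg_of_pi_div_two_lt_abs hθ hθ')]
  congr 1
  refine integral_congr_ae ?_
  filter_upwards [hS _ θ₀ h0 rfl ψ hψ] with t ht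
  rw [ht]

theorem mainTheorem2 (ω : ℝ) (hω₀ : 0 ≤ ω) (hω₁ : ω < 1) :
    (∀ θ₀ ∈ Ioo (-(Real.pi / 2)) (Real.pi / 2), ∃ ψ : ℝ → ℝ → ℝ, IsDiffuseFlux ω θ₀ ψ) ∧
    (∃ D : ℝ → ℝ → ℝ, IsDiffuseReflection ω D) ∧
    (∀ D : ℝ → ℝ → ℝ, IsDiffuseReflection ω D →
      ∀ θ₀ ∈ Ioo (-(Real.pi / 2)) (Real.pi / 2),
        ∀ θ ∈ Ioc (-Real.pi) Real.pi, Real.pi / 2 < |θ| →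
          D (Real.cos θ₀) (-Real.cos θ) = D (-Real.cos θ) (Real.cos θ₀)) := by
  refine ⟨fun θ₀ hθ₀ => ?_, exists_isDiffuseReflection hω₀ hω₁, fun D hD θ₀ hθ₀ θ hθ hθ' => ?_⟩
  · obtain ⟨ψ, _, _, hψ, -⟩ :=
      exists_isDiffuseFlux_source_eq hω₀ hω₁ (Real.cos_pos_of_mem_Ioo hθ₀)
    exact ⟨ψ, hψ⟩
  · have hθπ : |θ| ≤ Real.pi := abs_le.2 ⟨hθ.1.le, hθ.2⟩
    have hθ₀' : |θ₀| < Real.pi / 2 := abs_lt.2 hθ₀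
    have hπ := Real.pi_pos
    have h₀ := abs_nonneg θ₀
    -- The interchanged experiment has incident angle `π - |θ|` and emergent angle `π - |θ₀|`; the
    -- absolute values keep both in the admissible ranges.
    have hcos : Real.cos (Real.pi - |θ|) = -Real.cos θ := by rw [Real.cos_pi_sub, Real.cos_abs]
    have hcos₀ : -Real.cos (Real.pi - |θ₀|) = Real.cos θ₀ := by
      rw [Real.cos_pi_sub, Real.cos_abs, neg_neg]
    have hin : Real.pi - |θ| ∈ Ioo (-(Real.pi / 2)) (Real.pi / 2) :=
      ⟨by linarith, by linarith⟩
    have hout : Real.pi - |θ₀| ∈ Ioc (-Real.pi) Real.pi := ⟨by linarith, by linarith⟩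
    have hout' : Real.pi / 2 < |(Real.pi - |θ₀|)| := by
      rw [abs_of_nonneg (by linarith)]
      linarith
    obtain ⟨ψ, φ, hψ, hφ, h⟩ := integral_exp_mul_source_comm hω₀ hω₁
      (Real.cos_pos_of_mem_Ioo hθ₀) (Real.cos_pos_of_mem_Ioo hin)
    have h1 := hD.eq_integral hin hφ hout hout'
    rw [hcos₀, hcos, h] at h1
    rw [h1, hcos, hD.eq_integral hθ₀ hψ hθ hθ']
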